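/- Let $X$ be a locally compact, path connected, locally path connected and semilocally simply connected topological group with identity $e$. Let $\tilde X$ be its simply connected cover, realised as the set of endpoint-fixing homotopy classes $[f]$ of continuous paths $f\colon[0,1]\to X$ with $f(1)=e$, with covering map $p([f])=f(0)$, with the usual topology (basic open sets: all classes of paths $\delta\cdot f$, "first $\delta$, then $f$", with $f$ a fixed path from a point $y$ to $e$ and $\delta$ an arbitrary path ending at $y$ inside a fixed open path connected set $V\ni y$ all of whose loops are null-homotopic in $X$), and with the group structure $[f][g]=[t\mapsto f(t)g(t)]$. The fundamental group $\pi_1(X)=\pi_1(X,e)$ acts on $\tilde X$ by composition of path classes, $[\gamma]\cdot[f]=[\text{first } f,\text{ then }\gamma]$. Then $\tilde X$ is a locally compact, simply connected topological group, $p\colon\tilde X\to X$ is a group homomorphism and a covering map, and every (left) Haar measure $\mu$ on $\tilde X$ is $\pi_1(X)$-invariant: $\mu(\{a\in\tilde X : c\cdot a\in S\})=\mu(S)$ for every $c\in\pi_1(X)$ and every Borel set $S\subseteq\tilde X$. -/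

import Mathlib

open unitInterval Topology MeasureTheory

/-- Every point has a neighbourhood `U` such that each loop in `U` based at that point is
null-homotopic in `X` (endpoints fixed). -/
def SemilocallySimplyConnected (X : Type*) [TopologicalSpace X] : Prop :=
  ∀ x : X, ∃ U ∈ 𝓝 x, ∀ p : Path x x, (∀ t, p t ∈ U) → p.Homotopic (Path.refl x)

/-- `V` is relatively inessential in `X`: every loop in `V` is null-homotopic in `X`. -/
def IsRelativelyInessential {X : Type*} [TopologicalSpace X] (V : Set X) : Prop :=
  ∀ (v : X) (p : Path v v), (∀ t, p t ∈ V) → p.Homotopic (Path.refl v)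

/-- The paths in `X` ending at `x`, with arbitrary starting point. -/
def PathEndingAt {X : Type*} [TopologicalSpace X] (x : X) : Type _ :=
  {f : C(I, X) // f 1 = x}

namespace PathEndingAt

variable {X : Type*} [TopologicalSpace X] {x : X}

/-- A path ending at `x`, regarded as a `Path` from its starting point to `x`. -/
def toPath (f : PathEndingAt x) : Path (f.1 0) x where
  toContinuousMap := f.1
  source' := rfl
  target' := f.2

/-- A `Path` from `y` to `x`, regarded as a path ending at `x`. -/
def ofPath {y : X} (p : Path y x) : PathEndingAt x := ⟨p.toContinuousMap, p.target⟩

/-- Homotopy of paths with both endpoints fixed. -/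
instance setoid (x : X) : Setoid (PathEndingAt x) where
  r f g := f.1.HomotopicRel g.1 {0, 1}
  iseqv :=
    ⟨fun f => ContinuousMap.HomotopicRel.refl f.1, fun h => h.symm, fun h k => h.trans k⟩

theorem trans_congr {f g : PathEndingAt x} (h : f ≈ g) {p q : Path x x} (hpq : p.Homotopic q) :
    ofPath (f.toPath.trans p) ≈ ofPath (g.toPath.trans q) := by
  have h0 : f.1 0 = g.1 0 := ContinuousMap.HomotopicRel.fst_eq_snd h (by simp)
  have h' : f.toPath.Homotopic (g.toPath.cast h0 rfl) := h
  exact h'.hcomp hpq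

end PathEndingAt

/-- The universal covering space of `X` based at `x`: endpoint-fixing homotopy classes of paths
in `X` ending at `x`. This is the fibre over `x` of the range map of the fundamental groupoid. -/
def UniversalCover {X : Type*} [TopologicalSpace X] (x : X) : Type _ :=
  Quotient (PathEndingAt.setoid x)

namespace UniversalCover

section Space

variable {X : Type*} [TopologicalSpace X] {x : X}

/-- The class of a path from some point `y` to `x`. -/
def mk {y : X} (p : Path y x) : UniversalCover x := Quotient.mk _ (PathEndingAt.ofPath p)

/-- The covering map: a class of paths is sent to its starting point. -/
def proj : UniversalCover x → X :=
  Quotient.lift (fun f : PathEndingAt x => f.1 0)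
    fun _ _ h => ContinuousMap.HomotopicRel.fst_eq_snd h (by simp)

/-- The classes of all paths that run first inside `V` and then along `p`. -/
def basicNhd {y : X} (p : Path y x) (V : Set X) : Set (UniversalCover x) :=
  {a | ∃ (z : X) (δ : Path z y), (∀ t, δ t ∈ V) ∧ a = mk (δ.trans p)}

/-- The usual topology of the universal cover, generated by the sets `basicNhd p V` where `V` is
an open, path connected, relatively inessential set containing the starting point of `p`. -/
instance : TopologicalSpace (UniversalCover x) :=
  TopologicalSpace.generateFrom
    {N | ∃ (y : X) (p : Path y x) (V : Set X), IsOpen V ∧ IsPathConnected V ∧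
      IsRelativelyInessential V ∧ y ∈ V ∧ N = basicNhd p V}

instance : MeasurableSpace (UniversalCover x) := borel _

instance : BorelSpace (UniversalCover x) := ⟨rfl⟩

/-- The fundamental group acts by composition in the fundamental groupoid: `[γ] • [f]` is the class
of `f` followed by the loop `γ`. -/
noncomputable instance : SMul (FundamentalGroup X x) (UniversalCover x) where
  smul γ a := Quotient.map₂ (fun (p : Path x x) (f : PathEndingAt x) =>
    PathEndingAt.ofPath (f.toPath.trans p))
    (fun _ _ hpq _ _ hfg => PathEndingAt.trans_congr hfg hpq) γ.toPath a

noncomputable instance : MulAction (FundamentalGroup X x) (UniversalCover x) where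
  one_smul a := by
    induction a using Quotient.inductionOn with | h f =>
    exact Quotient.sound (Path.Homotopic.trans_refl f.toPath)
  mul_smul γ η a := by
    induction a using Quotient.inductionOn with | h f =>
    induction γ using Quotient.inductionOn with | h p =>
    induction η using Quotient.inductionOn with | h q =>
    exact Quotient.sound (Path.Homotopic.trans_assoc f.toPath q p).symm

end Space

section Group

variable {X : Type*} [TopologicalSpace X] [Group X] [IsTopologicalGroup X]

theorem mul_congr {f f' g g' : PathEndingAt (1 : X)} (hf : f ≈ f') (hg : g ≈ g') :
    (f.1 * g.1).HomotopicRel (f'.1 * g'.1) {0, 1} := by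
  obtain ⟨F⟩ := hf
  obtain ⟨G⟩ := hg
  exact ⟨{
    toContinuousMap := F.toContinuousMap * G.toContinuousMap
    map_zero_left := fun t => by simp
    map_one_left := fun t => by simp
    prop' := fun s t ht => congrArg₂ (· * ·) (F.prop' s t ht) (G.prop' s t ht) }⟩

theorem inv_congr {f f' : PathEndingAt (1 : X)} (hf : f ≈ f') :
    (f.1⁻¹).HomotopicRel (f'.1⁻¹) {0, 1} := by
  obtain ⟨F⟩ := hf
  exact ⟨{
    toContinuousMap := F.toContinuousMap⁻¹
    map_zero_left := fun t => by simp
    map_one_left := fun t => by simp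
    prop' := fun s t ht => congrArg (·⁻¹) (F.prop' s t ht) }⟩

/-- The group structure of the universal cover of a topological group, based at the identity:
paths are multiplied pointwise. -/
instance : Group (UniversalCover (1 : X)) where
  mul := Quotient.map₂
    (fun f g => (⟨f.1 * g.1, by simp [f.2, g.2]⟩ : PathEndingAt (1 : X)))
    fun _ _ hf _ _ hg => mul_congr hf hg
  one := Quotient.mk _ ⟨1, rfl⟩
  inv := Quotient.map (fun f => (⟨f.1⁻¹, by simp [f.2]⟩ : PathEndingAt (1 : X)))
    fun _ _ hf => inv_congr hf
  mul_assoc a b c := by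
    induction a using Quotient.inductionOn
    induction b using Quotient.inductionOn
    induction c using Quotient.inductionOn
    exact congrArg (Quotient.mk _) (Subtype.ext (mul_assoc _ _ _))
  one_mul a := by
    induction a using Quotient.inductionOn
    exact congrArg (Quotient.mk _) (Subtype.ext (one_mul _))
  mul_one a := by
    induction a using Quotient.inductionOn
    exact congrArg (Quotient.mk _) (Subtype.ext (mul_one _))
  inv_mul_cancel a := by
    induction a using Quotient.inductionOn
    exact congrArg (Quotient.mk _) (Subtype.ext (inv_mul_cancel _))

/-- The covering map of a topological group, as a group homomorphism. -/
def projHom (X : Type*) [TopologicalSpace X] [Group X] [IsTopologicalGroup X] :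
    UniversalCover (1 : X) →* X where
  toFun := proj
  map_one' := rfl
  map_mul' a b := by
    induction a using Quotient.inductionOn
    induction b using Quotient.inductionOn
    rfl

end Group

end UniversalCover

/-! The action of a loop class `[p]` is left multiplication by `mk p` (`smul_eq_mk_mul`): once
constant paths are inserted, pointwise product and concatenation agree, as in the Eckmann–Hilton
argument. Invariance of `μ` is then left invariance of Haar measure. The covering property also
comes from the group structure: `projHom` is an open surjective homomorphism with discrete kernel.
Simple connectedness follows from lifting paths by their final segments (`tail`), and local
compactness passes up the local homeomorphism. -/

namespace UniversalCover

/-! ### Basic neighbourhoods and final segments -/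

section Basis

variable {X : Type*} [TopologicalSpace X] {x : X}

theorem mk_eq_mk_iff {y : X} {p q : Path y x} : mk p = mk q ↔ p.Homotopic q := Quotient.eq

theorem exists_mk_eq (a : UniversalCover x) : ∃ (y : X) (p : Path y x), mk p = a := by
  induction a using Quotient.inductionOn with | h f =>
  exact ⟨_, f.toPath, rfl⟩

@[simp] theorem proj_mk {y : X} (p : Path y x) : proj (mk p) = y := p.source

theorem mk_trans_congr_left {y z : X} {δ ε : Path z y} (h : δ.Homotopic ε) (p : Path y x) :
    mk (δ.trans p) = mk (ε.trans p) :=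
  mk_eq_mk_iff.2 (h.hcomp (.refl p))

theorem mk_trans_congr_right {y z : X} (δ : Path z y) {p q : Path y x} (h : mk p = mk q) :
    mk (δ.trans p) = mk (δ.trans q) :=
  mk_eq_mk_iff.2 ((Path.Homotopic.refl δ).hcomp (mk_eq_mk_iff.1 h))

theorem mk_mem_basicNhd {y : X} (p : Path y x) {V : Set X} (hy : y ∈ V) :
    mk p ∈ basicNhd p V :=
  ⟨y, .refl y, fun _ => hy, mk_eq_mk_iff.2 (Path.Homotopic.refl_trans p).symm⟩

/-- Any class in a basic set can serve as its centre; this makes the basic sets a basis. -/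
theorem basicNhd_subset {y z : X} {p : Path y x} {q : Path z x} {V W : Set X}
    (h : mk q ∈ basicNhd p V) (hWV : W ⊆ V) : basicNhd q W ⊆ basicNhd p V := by
  obtain ⟨z', δ, hδ, e⟩ := h
  obtain rfl : z = z' := by simpa using congrArg proj e
  rintro _ ⟨w, ε, hε, rfl⟩
  refine ⟨w, ε.trans δ, fun t => ?_, ?_⟩
  · have : ε.trans δ t ∈ Set.range ε ∪ Set.range δ := Path.trans_range ε δ ▸ Set.mem_range_self t
    rcases this with ⟨s, hs⟩ | ⟨s, hs⟩
    · exact hs ▸ hWV (hε s)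
    · exact hs ▸ hδ s
  · rw [mk_trans_congr_right ε e]
    exact mk_eq_mk_iff.2 (Path.Homotopic.trans_assoc ε δ p).symm

/-- Two paths in `V` with the same endpoints form a loop in `V`, so they are homotopic in `X`. -/
theorem proj_injOn_basicNhd {y : X} (p : Path y x) {V : Set X} (hV : IsRelativelyInessential V) :
    Set.InjOn proj (basicNhd p V) := by
  rintro _ ⟨z, δ, hδ, rfl⟩ _ ⟨w, ε, hε, rfl⟩ h
  obtain rfl : z = w := by simpa using h
  refine mk_trans_congr_left ?_ p
  have key := hV z (δ.trans ε.symm) fun t => by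
    have : δ.trans ε.symm t ∈ Set.range δ ∪ Set.range ε.symm :=
      Path.trans_range δ ε.symm ▸ Set.mem_range_self t
    rcases this with ⟨s, hs⟩ | ⟨s, hs⟩
    · exact hs ▸ hδ s
    · exact hs ▸ hε _
  rw [← Path.Homotopic.Quotient.eq] at key ⊢
  rw [Path.Homotopic.Quotient.mk_trans, Path.Homotopic.Quotient.mk_symm,
    Path.Homotopic.Quotient.mk_refl] at key
  calc Path.Homotopic.Quotient.mk δ
      = ((Path.Homotopic.Quotient.mk δ).trans (.symm (.mk ε))).trans (.mk ε) := by simp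
    _ = .mk ε := by rw [key]; simp

theorem proj_mem_of_mem_basicNhd {y : X} {p : Path y x} {V : Set X} {a : UniversalCover x}
    (ha : a ∈ basicNhd p V) : proj a ∈ V := by
  obtain ⟨z, δ, hδ, rfl⟩ := ha
  simpa using hδ 0

theorem image_proj_basicNhd {y : X} (p : Path y x) {V : Set X} (hV : IsPathConnected V)
    (hy : y ∈ V) : proj '' basicNhd p V = V := by
  ext z
  constructor
  · rintro ⟨a, ha, rfl⟩
    exact proj_mem_of_mem_basicNhd ha
  · intro hz
    obtain ⟨δ, hδ⟩ := hV.joinedIn z hz y hy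
    exact ⟨mk (δ.trans p), ⟨z, δ, hδ, rfl⟩, proj_mk _⟩

theorem proj_surjective [PathConnectedSpace X] :
    Function.Surjective (proj : UniversalCover x → X) := fun y =>
  ⟨mk (PathConnectedSpace.somePath y x), proj_mk _⟩

/-- The path in the universal cover traced by the final segments of a path. -/
noncomputable def tail {y : X} (p : Path y x) (t : I) : UniversalCover x :=
  mk ((p.subpath t 1).cast rfl p.target.symm)

@[simp] theorem proj_tail {y : X} (p : Path y x) (t : I) : proj (tail p t) = p t := proj_mk _

@[simp] theorem tail_one {y : X} (p : Path y x) : tail p 1 = mk (Path.refl x) := by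
  obtain ⟨f, rfl, rfl⟩ := p
  simp only [tail, Path.subpath_self]
  rfl

@[simp] theorem tail_zero {y : X} (p : Path y x) : tail p 0 = mk p := by
  simp only [tail, Path.subpath_zero_one]
  rfl

end Basis

/-! ### Topology and simple connectedness of the cover -/

section Cover

variable {X : Type*} [TopologicalSpace X] [LocallyPathConnectedSpace X] {x : X}

/-- In a locally path connected, semilocally simply connected space, the open path connected
relatively inessential sets form a basis of the topology. -/
theorem exists_relativelyInessential_subset (hX : SemilocallySimplyConnected X) {y : X}
    {U : Set X} (hU : U ∈ 𝓝 y) :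
    ∃ V, IsOpen V ∧ IsPathConnected V ∧ IsRelativelyInessential V ∧ y ∈ V ∧ V ⊆ U := by
  obtain ⟨N, hN, hloop⟩ := hX y
  obtain ⟨V, ⟨hVo, hyV, hVc⟩, hVU⟩ :=
    (isOpen_isPathConnected_basis y).mem_iff.1 (Filter.inter_mem hU hN)
  refine ⟨V, hVo, hVc, fun v p hp => ?_, hyV, hVU.trans Set.inter_subset_left⟩
  obtain ⟨δ, hδ⟩ := hVc.joinedIn y hyV v (by simpa using hp 0)
  -- The hypothesis only concerns loops based at `y`, so `p` is conjugated by a path inside `V`.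
  have key := hloop ((δ.trans p).trans δ.symm) fun t => by
    have : (δ.trans p).trans δ.symm t ∈ (Set.range δ ∪ Set.range p) ∪ Set.range δ.symm :=
      Path.trans_range δ p ▸ Path.trans_range (δ.trans p) δ.symm ▸ Set.mem_range_self t
    refine (hVU ?_).2
    rcases this with (⟨s, hs⟩ | ⟨s, hs⟩) | ⟨s, hs⟩
    · exact hs ▸ hδ s
    · exact hs ▸ hp s
    · exact hs ▸ hδ _
  rw [← Path.Homotopic.Quotient.eq] at key ⊢
  simp only [Path.Homotopic.Quotient.mk_trans, Path.Homotopic.Quotient.mk_symm,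
    Path.Homotopic.Quotient.mk_refl] at key ⊢
  generalize Path.Homotopic.Quotient.mk δ = d at key
  generalize Path.Homotopic.Quotient.mk p = c at key
  calc c = (d.symm.trans ((d.trans c).trans d.symm)).trans d := by
        rw [Path.Homotopic.Quotient.trans_assoc, Path.Homotopic.Quotient.trans_assoc,
          Path.Homotopic.Quotient.trans_assoc, Path.Homotopic.Quotient.symm_trans,
          Path.Homotopic.Quotient.trans_refl, ← Path.Homotopic.Quotient.trans_assoc,
          Path.Homotopic.Quotient.symm_trans, Path.Homotopic.Quotient.refl_trans]
    _ = _ := by rw [key]; simp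

theorem isTopologicalBasis_basicNhd (hX : SemilocallySimplyConnected X) :
    TopologicalSpace.IsTopologicalBasis
      {N : Set (UniversalCover x) | ∃ (y : X) (p : Path y x) (V : Set X), IsOpen V ∧
        IsPathConnected V ∧ IsRelativelyInessential V ∧ y ∈ V ∧ N = basicNhd p V} where
  exists_subset_inter := by
    rintro _ ⟨y, p, V, hVo, hVc, -, hy, rfl⟩ _ ⟨z, q, W, hWo, hWc, -, hz, rfl⟩ a ⟨haV, haW⟩
    obtain ⟨w, r, rfl⟩ := exists_mk_eq a
    have hV : w ∈ V := by simpa using proj_mem_of_mem_basicNhd haV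
    have hW : w ∈ W := by simpa using proj_mem_of_mem_basicNhd haW
    obtain ⟨O, hOo, hOc, hOi, haO, hO⟩ := exists_relativelyInessential_subset hX
      ((hVo.inter hWo).mem_nhds ⟨hV, hW⟩)
    exact ⟨_, ⟨_, r, O, hOo, hOc, hOi, haO, rfl⟩, mk_mem_basicNhd r haO,
      Set.subset_inter (basicNhd_subset haV (hO.trans Set.inter_subset_left))
        (basicNhd_subset haW (hO.trans Set.inter_subset_right))⟩
  sUnion_eq := by
    refine Set.eq_univ_of_forall fun a => ?_
    obtain ⟨w, r, rfl⟩ := exists_mk_eq a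
    obtain ⟨O, hOo, hOc, hOi, haO, -⟩ :=
      exists_relativelyInessential_subset hX (y := w) Filter.univ_mem
    exact ⟨_, ⟨_, r, O, hOo, hOc, hOi, haO, rfl⟩, mk_mem_basicNhd r haO⟩
  eq_generateFrom := rfl

theorem nhds_mk_hasBasis (hX : SemilocallySimplyConnected X) {y : X} (p : Path y x) :
    (𝓝 (mk p)).HasBasis
      (fun V => IsOpen V ∧ IsPathConnected V ∧ IsRelativelyInessential V ∧ y ∈ V)
      (basicNhd p) := by
  refine (isTopologicalBasis_basicNhd hX).nhds_hasBasis.to_hasBasis ?_ ?_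
  · rintro _ ⟨⟨z, q, W, hWo, hWc, hWi, hz, rfl⟩, hp⟩
    have hy : y ∈ W := by simpa using proj_mem_of_mem_basicNhd hp
    exact ⟨W, ⟨hWo, hWc, hWi, hy⟩, basicNhd_subset hp subset_rfl⟩
  · rintro V ⟨hVo, hVc, hVi, hy⟩
    exact ⟨_, ⟨⟨y, p, V, hVo, hVc, hVi, hy, rfl⟩, mk_mem_basicNhd p hy⟩, subset_rfl⟩

theorem continuous_proj (hX : SemilocallySimplyConnected X) :
    Continuous (proj : UniversalCover x → X) := by
  refine continuous_iff_continuousAt.2 fun a => ?_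
  obtain ⟨y, p, rfl⟩ := exists_mk_eq a
  intro U hU
  rw [proj_mk] at hU
  obtain ⟨V, hVo, hVc, hVi, ha, hVU⟩ := exists_relativelyInessential_subset hX hU
  refine (nhds_mk_hasBasis hX p).mem_iff.2 ⟨V, ⟨hVo, hVc, hVi, ha⟩, fun b hb =>
    hVU (proj_mem_of_mem_basicNhd hb)⟩

theorem isOpenMap_proj (hX : SemilocallySimplyConnected X) :
    IsOpenMap (proj : UniversalCover x → X) := by
  refine (isTopologicalBasis_basicNhd hX).isOpenMap_iff.2 ?_
  rintro _ ⟨y, p, V, hVo, hVc, -, hy, rfl⟩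
  rwa [image_proj_basicNhd p hVc hy]

/-- For `s` near `t`, `tail p s` is the short segment of `p` from `s` to `t` followed by `tail p t`,
and that segment stays in `V`. -/
theorem continuous_tail (hX : SemilocallySimplyConnected X) {y : X} (p : Path y x) :
    Continuous (tail p) := by
  obtain ⟨f, rfl, rfl⟩ := p
  set p : Path (f 0) (f 1) := ⟨f, rfl, rfl⟩
  refine continuous_iff_continuousAt.2 fun t => ?_
  refine (nhds_mk_hasBasis hX _).tendsto_right_iff.2 ?_
  rintro V ⟨hVo, -, -, hy⟩
  obtain ⟨c, d, ht, hcd, hV⟩ := exists_Icc_mem_subset_of_mem_nhds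
    ((hVo.preimage p.continuous).mem_nhds hy)
  filter_upwards [hcd] with s hs
  refine ⟨p s, p.subpath s t, fun r => ?_, ?_⟩
  · have : p.subpath s t r ∈ p '' Set.uIcc s t :=
      Path.range_subpath p s t ▸ Set.mem_range_self r
    obtain ⟨u, hu, hur⟩ := this
    exact hur ▸ hV (Set.ordConnected_Icc.uIcc_subset hs ht hu)
  · exact mk_eq_mk_iff.2 ⟨(Path.Homotopy.subpathTransSubpath p s t 1).symm⟩

theorem simplyConnectedSpace_of_isCoveringMap (hX : SemilocallySimplyConnected X)
    (hproj : IsCoveringMap (proj : UniversalCover x → X)) :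
    SimplyConnectedSpace (UniversalCover x) := by
  have hjoin (a : UniversalCover x) : Joined a (mk (Path.refl x)) := by
    obtain ⟨y, p, rfl⟩ := exists_mk_eq a
    exact ⟨⟨⟨tail p, continuous_tail hX p⟩, tail_zero p, tail_one p⟩⟩
  have hpc : PathConnectedSpace (UniversalCover x) :=
    ⟨⟨mk (Path.refl x)⟩, fun a b => (hjoin a).trans (hjoin b).symm⟩
  -- A path ending at the base point is the lift of its projection.
  have hlift {a : UniversalCover x} (Γ : Path a (mk (Path.refl x))) :
      a = mk ((Γ.map (continuous_proj hX)).cast rfl (proj_mk _).symm) := by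
    have h := hproj.eq_of_comp_eq Γ.continuous (continuous_tail hX
      ((Γ.map (continuous_proj hX)).cast rfl (proj_mk _).symm))
      (funext fun t => by simp) 1 (by simp)
    simpa using congrFun h 0
  refine simply_connected_iff_loops_nullhomotopic.2 ⟨hpc, fun a γ => ?_⟩
  obtain ⟨Γ⟩ := hjoin a
  -- `γ.trans Γ` and `Γ` start at the same point `a`, so `hlift` makes their projections homotopic.
  -- This homotopy lifts, and cancelling `Γ` kills `γ`.
  have h := mk_eq_mk_iff.1 ((hlift (γ.trans Γ)).symm.trans (hlift Γ))
  have h' : (γ.trans Γ).Homotopic Γ :=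
    (hproj.homotopicRel_iff_comp (f₀ := (γ.trans Γ).toContinuousMap) (f₁ := Γ.toContinuousMap)
      ⟨0, .inl rfl, by simp⟩).2 h
  rw [← Path.Homotopic.Quotient.eq] at h' ⊢
  rw [Path.Homotopic.Quotient.mk_trans] at h'
  rw [Path.Homotopic.Quotient.mk_refl]
  generalize Path.Homotopic.Quotient.mk Γ = d at h'
  generalize Path.Homotopic.Quotient.mk γ = c at h'
  calc c = (c.trans d).trans d.symm := by simp
    _ = _ := by rw [h']; simp

end Cover

/-! ### The topological group structure -/

section TopologicalGroup

variable {X : Type*} [TopologicalSpace X] [Group X] [IsTopologicalGroup X]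

theorem mk_mul_mk {y z : X} (p : Path y 1) (q : Path z 1) :
    mk p * mk q = mk ((p.mul q).cast rfl (one_mul 1).symm) := rfl

theorem mk_inv {y : X} (p : Path y 1) :
    (mk p)⁻¹ = mk ((p.map continuous_inv).cast rfl inv_one.symm) := rfl

/-- A loop class acts on the universal cover by left multiplication. -/
theorem smul_eq_mk_mul (p : Path (1 : X) 1) (a : UniversalCover (1 : X)) :
    (FundamentalGroup.fromPath (Path.Homotopic.Quotient.mk p)) • a = mk p * a := by
  obtain ⟨y, q, rfl⟩ := exists_mk_eq a
  have h1 : mk p = mk ((Path.refl 1).trans p) :=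
    mk_eq_mk_iff.2 (Path.Homotopic.refl_trans p).symm
  have h2 : mk q = mk (q.trans (Path.refl 1)) :=
    mk_eq_mk_iff.2 (Path.Homotopic.trans_refl q).symm
  -- On each half of the interval one of the two factors is constantly `1`.
  have h3 : ((Path.refl 1).trans p).mul (q.trans (Path.refl 1)) =
      (q.trans p).cast (one_mul _) (one_mul 1) := by
    ext t
    simp only [Path.mul_apply, Path.cast_coe, Path.trans_apply]
    split_ifs <;> simp
  calc _ = mk (q.trans p) := rfl
    _ = mk ((Path.refl 1).trans p) * mk (q.trans (Path.refl 1)) := by rw [mk_mul_mk, h3]; rfl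
    _ = mk p * mk q := by rw [← h1, ← h2]

variable [LocallyPathConnectedSpace X]

/-- Pointwise products respect concatenation, `(δ·p)(ε·q) = (δε)·(pq)`, and so do inverses;
continuity reduces to that in `X`. -/
theorem isTopologicalGroup (hX : SemilocallySimplyConnected X) :
    IsTopologicalGroup (UniversalCover (1 : X)) where
  continuous_mul := by
    refine continuous_iff_continuousAt.2 fun ⟨a, b⟩ => ?_
    obtain ⟨y, p, rfl⟩ := exists_mk_eq a
    obtain ⟨z, q, rfl⟩ := exists_mk_eq b
    rw [ContinuousAt, nhds_prod_eq, mk_mul_mk]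
    refine (nhds_mk_hasBasis hX _).tendsto_right_iff.2 ?_
    rintro V ⟨hVo, -, -, hV⟩
    have hmul : (fun g : X × X => g.1 * g.2) ⁻¹' V ∈ 𝓝 (y, z) :=
      (hVo.preimage continuous_mul).mem_nhds hV
    rw [nhds_prod_eq] at hmul
    obtain ⟨U, hU, W, hW, hUW⟩ := Filter.mem_prod_iff.1 hmul
    obtain ⟨U', hUo, hUc, hUi, hyU, hUU⟩ := exists_relativelyInessential_subset hX hU
    obtain ⟨W', hWo, hWc, hWi, hzW, hWW⟩ := exists_relativelyInessential_subset hX hW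
    filter_upwards [Filter.prod_mem_prod
      ((nhds_mk_hasBasis hX p).mem_of_mem ⟨hUo, hUc, hUi, hyU⟩)
      ((nhds_mk_hasBasis hX q).mem_of_mem ⟨hWo, hWc, hWi, hzW⟩)]
    rintro ⟨_, _⟩ ⟨⟨u, δ, hδ, rfl⟩, w, ε, hε, rfl⟩
    refine ⟨u * w, δ.mul ε, fun t => hUW (Set.mk_mem_prod (hUU (hδ t)) (hWW (hε t))), ?_⟩
    rw [mk_mul_mk]
    refine congrArg mk ?_
    ext t
    simp only [Path.mul_apply, Path.cast_coe, Path.trans_apply]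
    split_ifs <;> simp
  continuous_inv := by
    refine continuous_iff_continuousAt.2 fun a => ?_
    obtain ⟨y, p, rfl⟩ := exists_mk_eq a
    rw [ContinuousAt, mk_inv]
    refine (nhds_mk_hasBasis hX _).tendsto_right_iff.2 ?_
    rintro V ⟨hVo, -, -, hV⟩
    have hinv : (fun g : X => g⁻¹) ⁻¹' V ∈ 𝓝 y := (hVo.preimage continuous_inv).mem_nhds hV
    obtain ⟨U, hUo, hUc, hUi, hyU, hU⟩ := exists_relativelyInessential_subset hX hinv
    filter_upwards [(nhds_mk_hasBasis hX p).mem_of_mem ⟨hUo, hUc, hUi, hyU⟩]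
    rintro _ ⟨u, δ, hδ, rfl⟩
    refine ⟨u⁻¹, δ.map continuous_inv, fun t => hU (hδ t), ?_⟩
    rw [mk_inv]
    refine congrArg mk ?_
    ext t
    simp only [Path.map_coe, Function.comp_apply, Path.cast_coe, Path.trans_apply]
    split_ifs <;> simp

/-- A basic neighbourhood of `1`, on which `proj` is injective, meets the kernel only in `1`. -/
theorem isDiscrete_ker_projHom (hX : SemilocallySimplyConnected X) :
    IsDiscrete ((projHom X).ker : Set (UniversalCover (1 : X))) := by
  have := isTopologicalGroup hX
  obtain ⟨V, hVo, hVc, hVi, hV, -⟩ :=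
    exists_relativelyInessential_subset hX (y := (1 : X)) Filter.univ_mem
  have hmem : (1 : UniversalCover (1 : X)) ∈ basicNhd (Path.refl (1 : X)) V :=
    mk_mem_basicNhd _ hV
  rw [SetLike.isDiscrete_iff_discreteTopology]
  refine discreteTopology_of_isOpen_singleton_one ?_
  refine isOpen_induced_iff.2 ⟨basicNhd (Path.refl (1 : X)) V,
    (isTopologicalBasis_basicNhd hX).isOpen ⟨_, _, V, hVo, hVc, hVi, hV, rfl⟩, ?_⟩
  ext ⟨a, ha⟩
  simp only [Set.mem_preimage, Set.mem_singleton_iff, Subgroup.mk_eq_one]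
  refine ⟨fun h => proj_injOn_basicNhd _ hVi h hmem ?_, fun h => h ▸ hmem⟩
  exact ha

theorem isCoveringMap_projHom [PathConnectedSpace X] (hX : SemilocallySimplyConnected X) :
    IsCoveringMap (projHom X) := by
  have := isTopologicalGroup hX
  refine (IsQuotientMap.isQuotientCoveringMap_of_isDiscrete_ker_monoidHom ?_
    (isDiscrete_ker_projHom hX)).isCoveringMap
  exact (isOpenMap_proj hX).isQuotientMap (continuous_proj hX) proj_surjective

end TopologicalGroup

end UniversalCover

/-- In a group one compact neighbourhood suffices; a local inverse at `1` supplies it. -/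
theorem IsLocalHomeomorph.locallyCompactSpace_of_group {G Y : Type*} [TopologicalSpace G]
    [Group G] [IsTopologicalGroup G] [TopologicalSpace Y] [LocallyCompactSpace Y] {f : G → Y}
    (hf : IsLocalHomeomorph f) : LocallyCompactSpace G := by
  obtain ⟨e, he, -⟩ := hf 1
  obtain ⟨K, hK, hKe, hKc⟩ := local_compact_nhds (e.open_target.mem_nhds (e.map_source he))
  refine (hKc.image_of_continuousOn (e.symm.continuousOn.mono hKe)
    ).locallyCompactSpace_of_mem_nhds_of_group (x := 1) ?_
  rw [e.symm.image_eq_target_inter_inv_preimage hKe]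
  exact Filter.inter_mem (e.open_source.mem_nhds he) (e.continuousAt he hK)

theorem mainTheorem9 (X : Type*) [TopologicalSpace X] [Group X] [IsTopologicalGroup X]
    [LocallyCompactSpace X] [PathConnectedSpace X] [LocallyPathConnectedSpace X]
    (hX : SemilocallySimplyConnected X) :
    -- the universal cover is a locally compact group and a simply connected covering of `X`
    IsTopologicalGroup (UniversalCover (1 : X)) ∧
    LocallyCompactSpace (UniversalCover (1 : X)) ∧
    SimplyConnectedSpace (UniversalCover (1 : X)) ∧
    IsCoveringMap (UniversalCover.projHom X) ∧
    -- its Haar measure is invariant under the fundamental group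
    ∀ (μ : Measure (UniversalCover (1 : X))) [μ.IsHaarMeasure],
      SMulInvariantMeasure (FundamentalGroup X (1 : X)) (UniversalCover (1 : X)) μ := by
  have hG := UniversalCover.isTopologicalGroup hX
  have hp := UniversalCover.isCoveringMap_projHom hX
  refine ⟨hG, hp.isLocalHomeomorph.locallyCompactSpace_of_group,
    UniversalCover.simplyConnectedSpace_of_isCoveringMap hX hp, hp, fun μ _ => ⟨fun c s hs => ?_⟩⟩
  obtain ⟨p, hc⟩ := Path.Homotopic.Quotient.mk_surjective c.toPath
  obtain rfl : FundamentalGroup.fromPath (Path.Homotopic.Quotient.mk p) = c := by rw [hc]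
  simp only [UniversalCover.smul_eq_mk_mul]
  exact (measurePreserving_mul_left μ _).measure_preimage hs.nullMeasurableSet
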